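/- Let $q$ be an odd prime power, $m>1$ an odd integer, $N=\frac{q^m-1}{q-1}$ (an odd integer), and let $\omega$ be a primitive element of $\mathbb F_{q^m}$. Write $\mathrm{Tr}$ for the trace from $\mathbb F_{q^m}$ to $\mathbb F_q$, $C_0$ for the set of nonzero squares of $\mathbb F_q$ and $C_1$ for the set of nonsquares. For $M\mid q^m-1$ let $C_t^{(M)}=\omega^t\langle\omega^M\rangle$ ($t\in\mathbb Z_M$). Let $p$ be the characteristic of $\mathbb F_q$, let $\psi(x)=\exp\left(\frac{2\pi i}{p}\mathrm{Tr}_{\mathbb F_{q^m}/\mathbb F_p}(x)\right)$ be the canonical additive character of $\mathbb F_{q^m}$, put $\psi(S)=\sum_{x\in S}\psi(x)$ for $S\subseteq \mathbb F_{q^m}$, and let $G_{q^m}(\eta)=\sum_{x\ne 0}\eta(x)\psi(x)$, where $\eta$ is the quadratic character of $\mathbb F_{q^m}$. Let $I=\{i \bmod N:\mathrm{Tr}(\omega^i)=0\}\subseteq\mathbb Z_N$, and let $2^{-1}I=\{2^{-1}i: i\in I\}\subseteq\mathbb Z_N$. Let $A=\{x\in\mathbb F_{q^m}^*:\mathrm{Tr}(x^2)=0\}$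 and, for $j=0,1$, $A_j=\{x\in\mathbb F_{q^m}^*:\mathrm{Tr}(x^2)\in C_j\}$. Put $r=\frac{m-1}2$. Choose successively $a_1,\dots,a_r\in\mathbb F_{q^m}^*$, linearly independent over $\mathbb F_q$, with $a_\ell\in A\cap H_1\cap\dots\cap H_{\ell-1}$, where $H_\ell=\{x\in\mathbb F_{q^m}^*:\mathrm{Tr}(xa_\ell)=0\}$, and put $H_{\ell,j}=\{x\in\mathbb F_{q^m}^*:\mathrm{Tr}(xa_\ell)\in C_j\}$ for $j=0,1$. Choose $b\in(H_1\cap\dots\cap H_r)\setminus A$. Let $$T_\ell=(A_0\cap H_1\cap\dots\cap H_{\ell-1}\cap H_{\ell,0})\cup(A_1\cap H_1\cap\dots\cap H_{\ell-1}\cap H_{\ell,1})\quad(1\le\ell\le r),$$ $$B=\{a_1x_1+\dots+a_rx_r+by: x_1,\dots,x_r\in\mathbb F_q,\ y\in C_0\},\qquad D=\Big(\bigcup_{\ell=1}^rT_\ell\Big)\cup B.$$ Such $a_1,\dots,a_r,b$ exist, and for every such choice the set $\widehat X=\{t\in\mathbb Z_{2N}: C_t^{(2N)}\subseteq D\}$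 has the following properties. 1. $D=\bigcup_{t\in\widehat X}C_t^{(2N)}$, and reduction modulo $N$ maps $\widehat X$ bijectively onto $\mathbb Z_N\setminus 2^{-1}I$. 2. There is a partition $P_1,P_2$ of $\mathbb Z_N\setminus I$ (a part may be empty) such that $\widehat X=2P_1''\cup(2P_2''+N)\pmod{2N}$, where $P_i''=4^{-1}P_i\subseteq\mathbb Z_N$. 3. For every integer $c$, the sum $$2\,\psi\Big(\omega^c\bigcup_{t\in\widehat X}C_t^{(2N)}\Big)-\psi\Big(\omega^c\bigcup_{t\in\mathbb Z_N\setminus2^{-1}I}C_t^{(N)}\Big)$$ equals $0$ if $c\bmod N\in 2^{-1}I$, and equals $G_{q^m}(\eta)$ or $-G_{q^m}(\eta)$ otherwise (the sign may depend on $c$). -/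

import Mathlib

open scoped Pointwise

noncomputable section

namespace SingerComplement

/-! ### Characters and Gauss sums of a finite field -/

/-- The canonical additive character `x ↦ exp (2 π i Tr(x) / p)` of a finite field `K` of
characteristic `p`, where `Tr` is the absolute trace `K → ZMod p`. -/
def canonicalAddChar (p : ℕ) [Fact p.Prime] (K : Type*) [Field K] [Algebra (ZMod p) K] :
    AddChar K ℂ :=
  (ZMod.stdAddChar (N := p)).compAddMonoidHom (Algebra.trace (ZMod p) K).toAddMonoidHom

/-- The quadratic Gauss sum `∑ x, η x * ψ x`, where `η` is the quadratic character of `K` and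
`ψ` its canonical additive character. -/
def quadraticGaussSum (p : ℕ) [Fact p.Prime] (K : Type*) [Field K] [Fintype K] [DecidableEq K]
    [Algebra (ZMod p) K] : ℂ :=
  gaussSum ((quadraticChar K).ringHomComp (Int.castRingHom ℂ)) (canonicalAddChar p K)

open Classical in
/-- `ψ(S) = ∑ x ∈ S, ψ x`. -/
def charSum {K : Type*} [Field K] [Fintype K] (ψ : AddChar K ℂ) (S : Set K) : ℂ :=
  ∑ x : K with x ∈ S, ψ x

/-! ### Cyclotomic classes -/

/-- The cyclotomic class `C_i = ω ^ i ⟨ω ^ M⟩`, for `i` in `ZMod M`; here `ω` is a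
primitive element of `K` and `M` divides `|K| - 1`. -/
def cyclotomicClass {K : Type*} [Field K] (ω : Kˣ) (M : ℕ) (i : ZMod M) : Set K :=
  {x | ∃ k : ℤ, x = ((ω ^ i.val * (ω ^ M) ^ k : Kˣ) : K)}

/-- The nonzero squares of a field. -/
def squareClass (F : Type*) [Field F] : Set F := {y | y ≠ 0 ∧ IsSquare y}

/-- The nonsquares of a field (`0` is a square). -/
def nonsquareClass (F : Type*) [Field F] : Set F := {y | ¬ IsSquare y}

/-! ### The Singer difference set and partitions of its complement -/

/-- `I = {i mod N : Tr(ω ^ i) = 0}`. -/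
def singerSet (F : Type*) {K : Type*} [Field F] [Field K] [Algebra F K] (ω : Kˣ) (N : ℕ) :
    Set (ZMod N) :=
  {i | Algebra.trace F K ((ω ^ i.val : Kˣ) : K) = 0}

/-- `2⁻¹ S` in `ZMod N`, for odd `N`. -/
def halve {N : ℕ} (S : Set (ZMod N)) : Set (ZMod N) := (fun i => (2 : ZMod N)⁻¹ * i) '' S

/-- The subset `2 T₁'' ∪ (2 T₂'' + N)` of `ZMod (2 * N)`, where `T'' = 4⁻¹ T`. -/
def liftPartition {N : ℕ} (T₁ T₂ : Set (ZMod N)) : Set (ZMod (2 * N)) :=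
  (fun j : ZMod N => 2 * (j.val : ZMod (2 * N))) '' halve (halve T₁) ∪
    (fun j : ZMod N => 2 * (j.val : ZMod (2 * N)) + (N : ZMod (2 * N))) '' halve (halve T₂)

/-! ### The quadric, its chain of tangent hyperplanes, and the set `D` -/

section Construction

variable (F : Type*) {K : Type*} [Field F] [Field K] [Algebra F K]

/-- `A`: the nonzero vectors of the quadric `Tr(x ^ 2) = 0`. -/
def quadric : Set K := {x | x ≠ 0 ∧ Algebra.trace F K (x ^ 2) = 0}

/-- `A_0`: the vectors for which `Tr(x ^ 2)` is a nonzero square. -/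
def quadricSq : Set K := {x | x ≠ 0 ∧ Algebra.trace F K (x ^ 2) ∈ squareClass F}

/-- `A_1`: the vectors for which `Tr(x ^ 2)` is a nonsquare. -/
def quadricNsq : Set K := {x | x ≠ 0 ∧ Algebra.trace F K (x ^ 2) ∈ nonsquareClass F}

/-- `H_a`: the nonzero vectors of the hyperplane `Tr(x a) = 0`. -/
def hyper (a : K) : Set K := {x | x ≠ 0 ∧ Algebra.trace F K (x * a) = 0}

/-- `H_{a,0}`: the vectors for which `Tr(x a)` is a nonzero square. -/
def hyperSq (a : K) : Set K := {x | x ≠ 0 ∧ Algebra.trace F K (x * a) ∈ squareClass F}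

/-- `H_{a,1}`: the vectors for which `Tr(x a)` is a nonsquare. -/
def hyperNsq (a : K) : Set K := {x | x ≠ 0 ∧ Algebra.trace F K (x * a) ∈ nonsquareClass F}

/-- The admissible choices `a_1, …, a_r` and `b`: each `a_ℓ` lies in
`A ∩ H_1 ∩ ⋯ ∩ H_{ℓ-1}`, the `a_ℓ` are linearly independent over `F`, and `b` lies in
`(H_1 ∩ ⋯ ∩ H_r) \ A`. The index `ℓ` starts from `0` here. -/
structure IsTangentChain {r : ℕ} (a : Fin r → K) (b : K) : Prop where
  mem_quadric : ∀ l, a l ∈ quadric F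
  mem_hyper : ∀ k l, k < l → a l ∈ hyper F (a k)
  linearIndependent : LinearIndependent F a
  base_mem : b ∈ (⋂ l, hyper F (a l)) \ quadric F

/-- `T_ℓ`, the union of `A_0 ∩ H_1 ∩ ⋯ ∩ H_{ℓ-1} ∩ H_{ℓ,0}` and
`A_1 ∩ H_1 ∩ ⋯ ∩ H_{ℓ-1} ∩ H_{ℓ,1}`. -/
def setT {r : ℕ} (a : Fin r → K) (l : Fin r) : Set K :=
  (quadricSq F ∩ (⋂ k, ⋂ (_ : k < l), hyper F (a k)) ∩ hyperSq F (a l)) ∪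
    (quadricNsq F ∩ (⋂ k, ⋂ (_ : k < l), hyper F (a k)) ∩ hyperNsq F (a l))

/-- `B`, the set of all `a_1 x_1 + ⋯ + a_r x_r + b y` with `x_i` in `F` and `y` a nonzero square
of `F`. -/
def setB {r : ℕ} (a : Fin r → K) (b : K) : Set K :=
  {z | ∃ (x : Fin r → F) (y : F), y ∈ squareClass F ∧ z = ∑ i, x i • a i + y • b}

/-- `D = T_1 ∪ ⋯ ∪ T_r ∪ B`. -/
def setD {r : ℕ} (a : Fin r → K) (b : K) : Set K := (⋃ l, setT F a l) ∪ setB F a b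

end Construction

/-- The indices `t` in `ZMod M` of the cyclotomic classes `C_t` of order `M` contained in `D`. -/
def classIndices {K : Type*} [Field K] (ω : Kˣ) (M : ℕ) (D : Set K) : Set (ZMod M) :=
  {t | cyclotomicClass ω M t ⊆ D}

/-- The combined character sum
`2 ψ(ω ^ c ⋃_{t ∈ X} C_t^{(2N)}) - ψ(ω ^ c ⋃_{t ∈ Y} C_t^{(N)})`, with `ψ` the canonical additive
character of `K`. -/
def combinedSum (p : ℕ) [Fact p.Prime] {K : Type*} [Field K] [Fintype K] [Algebra (ZMod p) K]
    (ω : Kˣ) (N : ℕ) (X : Set (ZMod (2 * N))) (Y : Set (ZMod N)) (c : ℤ) : ℂ :=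
  2 * charSum (canonicalAddChar p K)
      (((ω ^ c : Kˣ) : K) • (⋃ t ∈ X, cyclotomicClass ω (2 * N) t)) -
    charSum (canonicalAddChar p K) (((ω ^ c : Kˣ) : K) • (⋃ t ∈ Y, cyclotomicClass ω N t))

end SingerComplement

end

/-!
The statement lives on the quadratic space `K` over `F` with the form `B x y = Tr (x y)`, which is
nondegenerate of odd dimension `m = 2 r + 1`. Write `η` for the quadratic character of `F`, `ψ` for
its canonical additive character, and `G` for the quadratic Gauss sum of `K`.

*The signed indicator of `D`.* For a totally isotropic chain `a_1, …, a_r` and an anisotropic `b`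
orthogonal to it, let `f x = η(B x x) η(B x a_l)` for the first `l` with `B x a_l ≠ 0`, and
`f x = η(B b b) η(B x b)` if `x` is orthogonal to all `a_l`. Then `f` vanishes exactly on the
isotropic vectors, `D = {f = 1}`, and `f (s x) = η(s) f(x)` for `s ≠ 0` in `F`
(`IsIsotropicFlag.exists_flagSign`, `IsIsotropicFlag.mem_setD_iff`, `flagSign_smul`). A primitive
element `ω` satisfies `ω ^ N = Norm ω`, a nonsquare of `F` (`not_isSquare_norm`), so multiplication
by `ω ^ N` exchanges `D` with the set `{f = -1}`. This gives everything about indices: `D` is a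
union of classes of order `2 N`, and of `z` and `z + N` exactly one is an index of `D` if `ω ^ z` is
anisotropic, none otherwise.

*The character values.* The combined sum at `c` is the Fourier transform of `f` at `ω ^ c`, and `f`
is the sum of its `r + 1` pieces, which have disjoint supports. Each piece is an eigenvector of the
Fourier transform with eigenvalue `G` or `-G` (`IsIsotropicFlag.sum_flagSign_mul_addChar`), so the
transform vanishes at isotropic vectors and is `± G` elsewhere. The eigenvalue comes from
`∑ x, ψ (c * B x x) = η(c) G` for `c ≠ 0` in `F` (`sum_addChar_traceForm`; `m` odd is used to
identify the quadratic characters of `K` and `F` on `F`), a sum that is unchanged when restricted to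
the vectors orthogonal to some of the `a_l` (`sum_perp_quadratic`). The main computation is
`sum_tangent_mul_addChar`.

*Existence of the chain.* The same Gaussian sums, added over all `c`, show that one `|F|`-th of the
vectors orthogonal to an isotropic family is isotropic (`card_isotropic_mul_card`). Comparing with
the size of the span of the family, this extends the family until it has `r` members, and then
leaves an anisotropic vector orthogonal to it.
-/

namespace SingerComplement

/-! ### Translations of a subspace -/

section Translation

variable {F V : Type*} [Field F] [AddCommGroup V] [Module F V]

theorem sum_eq_zero_of_translate {A : Type*} [AddCommGroup A] [Fintype A] (f : A → ℂ) (w : A)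
    {z : ℂ} (hz : z ≠ 1) (h : ∀ x, f (x + w) = z * f x) : ∑ x, f x = 0 := by
  have h1 : ∑ x, f (x + w) = ∑ x, f x := Equiv.sum_comp (Equiv.addRight w) f
  simp only [h, ← Finset.mul_sum] at h1
  have h3 : (z - 1) * ∑ x, f x = 0 := by rw [sub_mul, h1, one_mul, sub_self]
  exact (mul_eq_zero.mp h3).resolve_left (sub_ne_zero.mpr hz)

open Classical in
theorem sum_submodule_translate [Fintype V] (U : Submodule F V) {w : V} (hw : w ∈ U) (f : V → ℂ) :
    ∑ x : U, f (x + w) = ∑ x : U, f x :=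
  Equiv.sum_comp (Equiv.addRight (⟨w, hw⟩ : U)) (fun x : U => f x)

open Classical in
theorem average_line [Fintype F] [Fintype V] (U : Submodule F V) {a : V} (ha : a ∈ U)
    (f : V → ℂ) :
    (Fintype.card F : ℂ) * ∑ x : U, f x = ∑ x : U, ∑ t : F, f (x + t • a) := by
  rw [Finset.sum_comm]
  simp [sum_submodule_translate U (U.smul_mem _ ha)]

theorem self_add_smul {B : LinearMap.BilinForm F V} (hB : B.IsSymm) (x y : V) (t : F) :
    B (x + t • y) (x + t • y) = B x x + 2 * t * B x y + t ^ 2 * B y y := by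
  have := hB.eq y x
  simp only [map_add, map_smul, LinearMap.add_apply, LinearMap.smul_apply, smul_eq_mul] at *
  rw [this]
  ring

end Translation

/-! ### Character sums over a tangent hyperplane -/

section Fourier

variable {F V : Type*} [Field F] [Fintype F] [DecidableEq F]

/-- The quadratic character of `F` with complex values. -/
noncomputable def quadChar (F : Type*) [Field F] [Fintype F] [DecidableEq F] : MulChar F ℂ :=
  (quadraticChar F).ringHomComp (Int.castRingHom ℂ)

theorem quadChar_apply (x : F) : quadChar F x = (quadraticChar F x : ℂ) := rfl

@[simp]
theorem quadChar_zero : quadChar F 0 = 0 := by simp [quadChar_apply]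

theorem quadChar_mul_self {x : F} (hx : x ≠ 0) : quadChar F x * quadChar F x = 1 := by
  rw [quadChar_apply, ← sq]
  exact_mod_cast quadraticChar_sq_one hx

theorem quadChar_inv (x : F) : quadChar F x⁻¹ = quadChar F x := by
  by_cases hx : x = 0
  · simp [hx]
  · have h := quadChar_mul_self hx
    have h' : quadChar F x⁻¹ * quadChar F x = 1 := by
      rw [← map_mul, inv_mul_cancel₀ hx, map_one]
    exact mul_right_cancel₀ (right_ne_zero_of_mul_eq_one h) (h'.trans h.symm)

theorem sum_quadChar_eq_zero (h2 : ringChar F ≠ 2) : ∑ t, quadChar F t = 0 := by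
  simp only [quadChar_apply]
  exact_mod_cast quadraticChar_sum_zero h2

theorem sum_quadChar_mul_addChar (h2 : ringChar F ≠ 2) (ψ : AddChar F ℂ) (s : F) :
    ∑ t, quadChar F t * ψ (t * s) = quadChar F s * gaussSum (quadChar F) ψ := by
  by_cases hs : s = 0
  · simp [hs, sum_quadChar_eq_zero h2]
  · have h := gaussSum_mulShift (quadChar F) ψ (Units.mk0 s hs)
    have h' := quadChar_mul_self hs
    simp only [Units.val_mk0] at h
    rw [← h, ← mul_assoc, h', one_mul]
    simp only [gaussSum, AddChar.mulShift_apply, mul_comm s]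

/-- For `v = 0` the sum is `0`, in accordance with `quadChar F 0 = 0`. -/
theorem sum_quadChar_affine_mul_addChar (h2 : ringChar F ≠ 2) (ψ : AddChar F ℂ) (d v : F) {c : F}
    (hc : c ≠ 0) :
    ∑ t, quadChar F (d + t * c) * ψ (t * v) =
      ψ (-(d * v / c)) * (quadChar F v * quadChar F c * gaussSum (quadChar F) ψ) := by
  rw [← quadChar_inv c, ← map_mul, ← sum_quadChar_mul_addChar h2, Finset.mul_sum]
  refine Fintype.sum_equiv ((Equiv.mulRight₀ c hc).trans (Equiv.addLeft d)) _ _ fun t => ?_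
  simp only [Equiv.trans_apply, Equiv.mulRight₀_apply, Equiv.coe_addLeft]
  rw [mul_left_comm, ← AddChar.map_add_eq_mul]
  congr 2
  field_simp
  ring

theorem gaussSum_quadChar_sq (h2 : ringChar F ≠ 2) {ψ : AddChar F ℂ} (hψ : ψ.IsPrimitive) :
    gaussSum (quadChar F) ψ * gaussSum (quadChar F) ψ = quadChar F (-1) * Fintype.card F := by
  rw [← sq]
  refine gaussSum_sq ?_ ((quadraticChar_isQuadratic F).comp _) hψ
  exact (MulChar.ringHomComp_ne_one_iff (RingHom.injective_int _)).mpr (quadraticChar_ne_one h2)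

theorem sum_addChar_mul (ψ : AddChar F ℂ) (hψ : ψ.IsPrimitive) (b : F) :
    ∑ t, ψ (t * b) = if b = 0 then (Fintype.card F : ℂ) else 0 := by
  rw [AddChar.sum_mulShift b hψ]
  split_ifs <;> simp

variable [AddCommGroup V] [Module F V] [Fintype V] {B : LinearMap.BilinForm F V}

open Classical in
/-- Restricting a quadratic character sum to the hyperplane tangent at an isotropic vector `a` does
not change it: averaging over translations along `a` kills the terms with `B x a ≠ 0`. -/
theorem sum_quadratic_tangent (hB : B.IsSymm) (h2 : ringChar F ≠ 2) {ψ : AddChar F ℂ}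
    (hψ : ψ.IsPrimitive) (U : Submodule F V) {a : V} (ha : a ∈ U) (haa : B a a = 0) {c : F}
    (hc : c ≠ 0) :
    ∑ x : U, (if B x a = 0 then ψ (c * B x x) else 0) = ∑ x : U, ψ (c * B x x) := by
  have hq : (Fintype.card F : ℂ) ≠ 0 := by simp
  refine mul_left_cancel₀ hq ?_
  rw [average_line U ha (fun x => ψ (c * B x x)), Finset.mul_sum]
  refine Finset.sum_congr rfl fun x _ => ?_
  have (t : F) : ψ (c * B (x + t • a) (x + t • a)) =
      ψ (c * B x x) * ψ (t * (2 * c * B x a)) := by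
    rw [← AddChar.map_add_eq_mul, self_add_smul hB, haa]
    congr 1
    ring
  simp only [this, ← Finset.mul_sum, sum_addChar_mul ψ hψ, mul_eq_zero, Ring.two_ne_zero h2, hc,
    false_or]
  split_ifs <;> ring

open Classical in
/-- The function `η(B x x) η(B x a)` on a subspace `U` containing the isotropic vector `a` is an
eigenvector of the Fourier transform. Averaging over translations along `a` makes the summand
Gaussian in `x` on each affine hyperplane `B x a = s`, where completing the square reduces the sum
to the Gaussian sum over the tangent hyperplane `B x a = 0`. -/
theorem sum_tangent_mul_addChar (hB : B.IsSymm) (h2 : ringChar F ≠ 2) {ψ : AddChar F ℂ}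
    (hψ : ψ.IsPrimitive) (U : Submodule F V) {a : V} (ha : a ∈ U) (haa : B a a = 0) {G : ℂ}
    (hG : ∀ c : F, c ≠ 0 → ∑ x : U, ψ (c * B x x) = quadChar F c * G) {y : V} (hy : y ∈ U) :
    ∑ x : U, quadChar F (B x x) * quadChar F (B x a) * ψ (B x y) =
      quadChar F 2 * G * (quadChar F (B y y) * quadChar F (B y a)) := by
  have h20 : (2 : F) ≠ 0 := Ring.two_ne_zero h2
  have hq : (Fintype.card F : ℂ) ≠ 0 := by simp
  set g := gaussSum (quadChar F) ψ with hg
  set v := B y a with hv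
  have hav : B a y = v := hB.eq a y
  -- averaging over the line spanned by `a`
  have h1 : (Fintype.card F : ℂ) * ∑ x : U, quadChar F (B x x) * quadChar F (B x a) * ψ (B x y) =
      quadChar F 2 * quadChar F v * g *
        ∑ x : U, if B x a = 0 then 0 else ψ (B x y - B x x * v / (2 * B x a)) := by
    rw [average_line U ha (fun x => quadChar F (B x x) * quadChar F (B x a) * ψ (B x y)),
      Finset.mul_sum]
    refine Finset.sum_congr rfl fun x _ => ?_
    by_cases hu : B x a = 0
    · simp [hu, haa, quadChar_zero]
    · have (t : F) : quadChar F (B (x + t • a) (x + t • a)) * quadChar F (B (x + t • a) a) *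
          ψ (B (x + t • a) y) = quadChar F (B x a) * ψ (B x y) *
            (quadChar F (B x x + t * (2 * B x a)) * ψ (t * v)) := by
        have e1 : B (x + t • a) y = B x y + t * v := by simp [hav]
        have e2 : B (x + t • a) a = B x a := by simp [haa]
        rw [self_add_smul hB, haa, e1, e2, AddChar.map_add_eq_mul,
          show B x x + 2 * t * B x a + t ^ 2 * 0 = B x x + t * (2 * B x a) by ring]
        ring
      simp only [this, ← Finset.mul_sum, if_neg hu]
      rw [sum_quadChar_affine_mul_addChar h2 ψ _ _ (mul_ne_zero h20 hu), sub_eq_add_neg,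
        AddChar.map_add_eq_mul, map_mul]
      linear_combination (ψ (B x y) * ψ (-(B x x * v / (2 * B x a))) * quadChar F v *
        quadChar F 2 * g) * quadChar_mul_self hu
  refine mul_left_cancel₀ hq (h1.trans ?_)
  by_cases hv0 : v = 0
  · simp [hv0]
  -- completing the square on the affine hyperplanes `B x a = s`
  have h3 (s : F) (hs : s ≠ 0) :
      ∑ x : U, (if B x a = s then ψ (B x y - B x x * v / (2 * s)) else 0) =
        quadChar F (-1) * quadChar F 2 * quadChar F v * G *
          (quadChar F s * ψ (s * (B y y * (2 * v)⁻¹))) := by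
    have hc : -(v / (2 * s)) ≠ 0 := neg_ne_zero.mpr (div_ne_zero hv0 (mul_ne_zero h20 hs))
    rw [← sum_submodule_translate U (U.smul_mem (s / v) hy)
      (fun x => if B x a = s then ψ (B x y - B x x * v / (2 * s)) else 0)]
    have e (x : U) : (if B (x + (s / v) • y) a = s then ψ (B (x + (s / v) • y) y -
          B (x + (s / v) • y) (x + (s / v) • y) * v / (2 * s)) else 0) =
        ψ (s * (B y y * (2 * v)⁻¹)) *
          (if B x a = 0 then ψ (-(v / (2 * s)) * B x x) else 0) := by
      have e1 : B ((x : V) + (s / v) • y) a = B x a + s := by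
        simp only [map_add, map_smul, LinearMap.add_apply, LinearMap.smul_apply, smul_eq_mul, ← hv]
        field_simp
      have e2 : B ((x : V) + (s / v) • y) y = B x y + s / v * B y y := by simp
      rw [e1, e2, self_add_smul hB, mul_ite, mul_zero, ← AddChar.map_add_eq_mul]
      simp only [add_eq_right]
      congr 2
      field_simp
      ring
    simp only [e, ← Finset.mul_sum]
    rw [sum_quadratic_tangent hB h2 hψ U ha haa hc, hG _ hc,
      show -(v / (2 * s)) = -1 * (2⁻¹ * v * s⁻¹) by field_simp]
    simp only [map_mul, quadChar_inv]
    ring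
  have h4 : ∑ x : U, (if B x a = 0 then 0 else ψ (B x y - B x x * v / (2 * B x a))) =
      quadChar F (-1) * quadChar F 2 * quadChar F v * G *
        ∑ s, quadChar F s * ψ (s * (B y y * (2 * v)⁻¹)) := by
    rw [Finset.mul_sum]
    have e (s : F) : quadChar F (-1) * quadChar F 2 * quadChar F v * G *
          (quadChar F s * ψ (s * (B y y * (2 * v)⁻¹))) =
        ∑ x : U, if B x a = s then
          (if B x a = 0 then 0 else ψ (B x y - B x x * v / (2 * B x a))) else 0 := by
      by_cases hs : s = 0
      · subst hs
        simp only [MulChar.map_zero, zero_mul, mul_zero]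
        refine (Finset.sum_eq_zero fun x _ => ?_).symm
        split_ifs <;> rfl
      · rw [← h3 s hs]
        refine Finset.sum_congr rfl fun x _ => ?_
        split_ifs with h h'
        · exact absurd (h.symm.trans h') hs
        · rw [h]
        · rfl
    simp only [e]
    rw [Finset.sum_comm]
    simp
  rw [h4, sum_quadChar_mul_addChar h2, ← hg]
  simp only [map_mul, quadChar_inv]
  have e1 := gaussSum_quadChar_sq h2 hψ
  rw [← hg] at e1
  have e2 := quadChar_mul_self h20
  have e3 := quadChar_mul_self hv0
  have e4 := quadChar_mul_self (neg_ne_zero.mpr (one_ne_zero (α := F)))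
  generalize quadChar F 2 = c2 at *
  generalize quadChar F v = cv at *
  generalize quadChar F (-1) = cn at *
  generalize quadChar F (B y y) = cy at *
  have : c2 * cv * g * (cn * c2 * cv * G * (cy * (c2 * cv) * g)) =
    (c2 * c2) * (cv * cv) * (g * g) * cn * (c2 * cv * G * cy) := by ring
  rw [this, e1, e2, e3]
  linear_combination (Fintype.card F * (c2 * cv * G * cy)) * e4

end Fourier

/-! ### Isotropic flags -/

section Flag

variable {F V : Type*} [Field F] [AddCommGroup V] [Module F V] (B : LinearMap.BilinForm F V)
  {r : ℕ} (a : Fin r → V) (b : V)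

/-- The vectors orthogonal to the first `n` members of the family `a`. -/
def perp (n : ℕ) : Submodule F V where
  carrier := {x | ∀ k : Fin r, k.val < n → B x (a k) = 0}
  zero_mem' := by simp
  add_mem' := by
    intro x y hx hy k hk
    simp [hx k hk, hy k hk]
  smul_mem' := by
    intro c x hx k hk
    simp [hx k hk]

/-- A totally isotropic family `a` and an anisotropic vector `b` orthogonal to it, which together
span the orthogonal space of `a`. -/
structure IsIsotropicFlag : Prop where
  isotropic : ∀ k l, B (a k) (a l) = 0
  orthogonal : ∀ k, B b (a k) = 0
  anisotropic : B b b ≠ 0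
  exists_coords : ∀ x ∈ perp B a r, ∃ (c : Fin r → F) (y : F), x = ∑ i, c i • a i + y • b

variable {B a b}

theorem mem_perp {n : ℕ} {x : V} :
    x ∈ perp B a n ↔ ∀ k : Fin r, k.val < n → B x (a k) = 0 := Iff.rfl

theorem mem_perp_all {x : V} : x ∈ perp B a r ↔ ∀ k, B x (a k) = 0 :=
  ⟨fun h k => h k k.isLt, fun h k _ => h k⟩

theorem mem_perp_succ (l : Fin r) {x : V} :
    x ∈ perp B a (l + 1) ↔ x ∈ perp B a l ∧ B x (a l) = 0 := by
  refine ⟨fun h => ⟨fun k hk => h k (by omega), h l (by omega)⟩, fun h k hk => ?_⟩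
  rcases Nat.lt_succ_iff_lt_or_eq.mp hk with hk | hk
  · exact h.1 k hk
  · rw [Fin.ext hk]
    exact h.2

theorem IsIsotropicFlag.apply_mul (h : IsIsotropicFlag B a b) (hB : B.IsSymm) {x y : V}
    (hx : x ∈ perp B a r) (hy : y ∈ perp B a r) : B x y * B b b = B x b * B y b := by
  obtain ⟨c, t, rfl⟩ := h.exists_coords x hx
  have h1 (i : Fin r) : B (a i) y = 0 := by
    rw [← hB.eq]
    exact hy i i.isLt
  have h2 (i : Fin r) : B (a i) b = 0 := by
    rw [← hB.eq]
    exact h.orthogonal i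
  have h3 : B b y = B y b := hB.eq b y
  simp only [map_add, map_sum, map_smul, LinearMap.add_apply, LinearMap.sum_apply,
    LinearMap.smul_apply, smul_eq_mul, h1, h2, mul_zero, Finset.sum_const_zero, zero_add, h3]
  ring

/-- The Fourier transform of a function that is invariant under translation by the multiples of
`a k`, for `k < n`, is supported on `perp B a n`. -/
theorem sum_mul_addChar_eq_zero [Fintype V] {ψ : AddChar F ℂ} (hψ : ψ.IsPrimitive)
    {f : V → ℂ} {n : ℕ} (hB : B.IsSymm)
    (hf : ∀ (k : Fin r), k.val < n → ∀ (t : F) x, f (x + t • a k) = f x) {y : V}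
    (hy : y ∉ perp B a n) : ∑ x, f x * ψ (B x y) = 0 := by
  rw [mem_perp] at hy
  push Not at hy
  obtain ⟨k, hk, hne⟩ := hy
  have hψ' := hψ hne
  obtain ⟨t, ht⟩ := AddChar.ne_one_iff.mp hψ'
  rw [AddChar.mulShift_apply] at ht
  refine sum_eq_zero_of_translate _ (t • a k) ht fun x => ?_
  have e : B (x + t • a k) y = B y (a k) * t + B x y := by
    have := hB.eq y (a k)
    simp only [map_add, map_smul, LinearMap.add_apply, LinearMap.smul_apply, smul_eq_mul, ← this]
    ring
  rw [hf k hk, e, AddChar.map_add_eq_mul]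
  ring

end Flag

/-! ### Eigenfunctions of the Fourier transform -/

section Eigenfunctions

variable {F V : Type*} [Field F] [Fintype F] [DecidableEq F]

theorem sum_addChar_mul_sq (h2 : ringChar F ≠ 2) {ψ : AddChar F ℂ} (hψ : ψ.IsPrimitive) {c : F}
    (hc : c ≠ 0) : ∑ u, ψ (c * u ^ 2) = quadChar F c * gaussSum (quadChar F) ψ := by
  have h1 : ∑ u, ψ (c * u ^ 2) = ∑ z, (quadChar F z + 1) * ψ (z * c) := by
    rw [← Finset.sum_fiberwise (s := Finset.univ) (g := fun u : F => u ^ 2)]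
    refine Finset.sum_congr rfl fun z _ => ?_
    have h := quadraticChar_card_sqrts h2 z
    rw [Finset.sum_congr rfl (g := fun _ => ψ (z * c))
      (fun u hu => by rw [(Finset.mem_filter.mp hu).2, mul_comm])]
    rw [Finset.sum_const, nsmul_eq_mul, quadChar_apply]
    congr 1
    rw [Set.toFinset_ofPred] at h
    exact_mod_cast congrArg (Int.cast : ℤ → ℂ) h
  simp only [h1, add_mul, one_mul, Finset.sum_add_distrib]
  rw [sum_quadChar_mul_addChar h2, sum_addChar_mul ψ hψ, if_neg hc, add_zero]

variable [AddCommGroup V] [Module F V] (B : LinearMap.BilinForm F V) {r : ℕ} (a : Fin r → V) (b : V)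

open Classical in
/-- The pieces of the signed indicator function of the set `D`. The piece `some l` is
`η(B x x) η(B x a_l)` on the vectors orthogonal to all `a_k` with `k < l`, the piece `none` is
`η(B b b) η(B x b)` on the vectors orthogonal to all `a_k`, and they vanish elsewhere. -/
noncomputable def flagSign : Option (Fin r) → V → ℤ
  | some l, x => if x ∈ perp B a l then quadraticChar F (B x x) * quadraticChar F (B x (a l)) else 0
  | none, x => if x ∈ perp B a r then quadraticChar F (B b b) * quadraticChar F (B x b) else 0

variable {B a b}

theorem flagSign_smul (i : Option (Fin r)) {s : F} (hs : s ≠ 0) (x : V) :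
    flagSign B a b i (s • x) = quadraticChar F s * flagSign B a b i x := by
  have h := quadraticChar_sq_one hs
  rcases i with _ | l
  · by_cases hx : x ∈ perp B a r
    · rw [flagSign, flagSign, if_pos hx, if_pos (Submodule.smul_mem _ _ hx)]
      simp only [map_smul, LinearMap.smul_apply, smul_eq_mul, map_mul]
      ring
    · rw [flagSign, flagSign, if_neg hx, if_neg (mt (Submodule.smul_mem_iff _ hs).mp hx), mul_zero]
  · by_cases hx : x ∈ perp B a l
    · rw [flagSign, flagSign, if_pos hx, if_pos (Submodule.smul_mem _ _ hx)]
      simp only [map_smul, LinearMap.smul_apply, smul_eq_mul, map_mul]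
      linear_combination (quadraticChar F s * quadraticChar F (B x x) *
        quadraticChar F (B x (a l))) * h
    · rw [flagSign, flagSign, if_neg hx, if_neg (mt (Submodule.smul_mem_iff _ hs).mp hx), mul_zero]

theorem IsIsotropicFlag.flagSign_eq_zero (h : IsIsotropicFlag B a b) (hB : B.IsSymm) {x : V}
    (hx : B x x = 0) (i : Option (Fin r)) : flagSign B a b i x = 0 := by
  rcases i with _ | l
  · simp only [flagSign]
    split_ifs with hm
    · have h1 := h.apply_mul hB hm hm
      rw [hx, zero_mul] at h1
      simp [mul_self_eq_zero.mp h1.symm]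
    · rfl
  · simp [flagSign, hx]

/-- The supports of the pieces partition the anisotropic vectors: the piece that does not vanish at
`x` is given by the first `a_l` not orthogonal to `x`. -/
theorem IsIsotropicFlag.exists_flagSign (h : IsIsotropicFlag B a b) (hB : B.IsSymm) {x : V}
    (hx : B x x ≠ 0) : ∃ i, (flagSign B a b i x = 1 ∨ flagSign B a b i x = -1) ∧
      ∀ j ≠ i, flagSign B a b j x = 0 := by
  by_cases hm : x ∈ perp B a r
  · refine ⟨none, ?_, fun j hj => ?_⟩
    · have h1 : B x b ≠ 0 := by
        intro h0
        have h1 := h.apply_mul hB hm hm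
        rw [h0, zero_mul] at h1
        exact mul_ne_zero hx h.anisotropic h1
      rw [flagSign, if_pos hm, ← map_mul]
      exact quadraticChar_dichotomy (mul_ne_zero h.anisotropic h1)
    · obtain ⟨l, rfl⟩ := Option.ne_none_iff_exists'.mp hj
      simp [flagSign, mem_perp_all.mp hm l]
  · have hm' : ∃ k, B x (a k) ≠ 0 := by
      by_contra! hcon
      exact hm (mem_perp_all.mpr hcon)
    obtain ⟨l, hl, hmin⟩ := WellFounded.has_min (wellFounded_lt (α := Fin r))
      {k | B x (a k) ≠ 0} hm'
    have hxl : x ∈ perp B a l := fun k hk => by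
      by_contra hne
      exact hmin k hne hk
    refine ⟨some l, ?_, fun j hj => ?_⟩
    · rw [flagSign, if_pos hxl, ← map_mul]
      exact quadraticChar_dichotomy (mul_ne_zero hx hl)
    · rcases j with _ | k
      · simp [flagSign, hm]
      · have hkl : k ≠ l := fun e => hj (by rw [e])
        rcases lt_or_gt_of_ne hkl with hlt | hlt
        · simp [flagSign, hxl k hlt]
        · have : x ∉ perp B a k := fun hc => hl (hc l hlt)
          simp [flagSign, this]

theorem IsIsotropicFlag.flagSign_add_smul (h : IsIsotropicFlag B a b) (hB : B.IsSymm) (k : Fin r)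
    (t : F) (x : V) :
    (∀ l, k < l → flagSign B a b (some l) (x + t • a k) = flagSign B a b (some l) x) ∧
      flagSign B a b none (x + t • a k) = flagSign B a b none x := by
  have e (y : V) (hy : B (a k) y = 0) : B (x + t • a k) y = B x y := by simp [hy]
  have hm (n : ℕ) : x + t • a k ∈ perp B a n ↔ x ∈ perp B a n := by
    simp only [mem_perp, e _ (h.isotropic k _)]
  have hab : B (a k) b = 0 := by
    rw [← hB.eq]
    exact h.orthogonal k
  refine ⟨fun l hl => ?_, ?_⟩
  · by_cases hx : x ∈ perp B a l
    · rw [flagSign, flagSign, if_pos hx, if_pos ((hm _).mpr hx), e _ (h.isotropic k _),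
        self_add_smul hB, hx k hl, h.isotropic, mul_zero, mul_zero, add_zero, add_zero]
    · rw [flagSign, flagSign, if_neg hx, if_neg (mt (hm _).mp hx)]
  · by_cases hx : x ∈ perp B a r
    · rw [flagSign, flagSign, if_pos hx, if_pos ((hm _).mpr hx), e _ hab]
    · rw [flagSign, flagSign, if_neg hx, if_neg (mt (hm _).mp hx)]

variable [Fintype V]

open Classical in
theorem sum_perp_quadratic (hB : B.IsSymm) (h2 : ringChar F ≠ 2) {ψ : AddChar F ℂ}
    (hψ : ψ.IsPrimitive) (hiso : ∀ k l, B (a k) (a l) = 0) {c : F} (hc : c ≠ 0) {n : ℕ}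
    (hn : n ≤ r) : ∑ x : perp B a n, ψ (c * B x x) = ∑ x, ψ (c * B x x) := by
  have hsub (U : Submodule F V) (f : V → ℂ) : ∑ x : U, f x = ∑ x, if x ∈ U then f x else 0 := by
    rw [← Finset.sum_filter]
    exact (Finset.sum_subtype _ (by simp) _).symm
  induction n with
  | zero =>
    rw [hsub _ (fun x => ψ (c * B x x))]
    exact Finset.sum_congr rfl fun x _ => if_pos fun k hk => absurd hk (Nat.not_lt_zero _)
  | succ n ih =>
    have hmem : a ⟨n, hn⟩ ∈ perp B a n := fun k _ => hiso _ _
    rw [← ih (by omega), ← sum_quadratic_tangent hB h2 hψ _ hmem (hiso _ _) hc,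
      hsub _ (fun x => ψ (c * B x x)),
      hsub _ (fun x => if B x (a ⟨n, hn⟩) = 0 then ψ (c * B x x) else 0)]
    refine Finset.sum_congr rfl fun x _ => ?_
    have := mem_perp_succ (B := B) (a := a) ⟨n, hn⟩ (x := x)
    simp only at this
    simp only [this, ite_and]

open Classical in
/-- The eigenvalue equation of the last piece. On the vectors orthogonal to the whole family the
form is `B x y = B x b * B y b / B b b`, so both `G` and the transform are multiples of sums over
the values of `B x b` in `F`. -/
theorem sum_perp_mul_addChar (hB : B.IsSymm) (h2 : ringChar F ≠ 2) {ψ : AddChar F ℂ}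
    (hψ : ψ.IsPrimitive) (h : IsIsotropicFlag B a b) {G : ℂ}
    (hG : ∑ x : perp B a r, ψ (B x x) = G) {y : V} (hy : y ∈ perp B a r) :
    ∑ x : perp B a r, quadChar F (B b b) * quadChar F (B x b) * ψ (B x y) =
      G * (quadChar F (B b b) * quadChar F (B y b)) := by
  have hq : (Fintype.card F : ℂ) ≠ 0 := by simp
  have hb := h.anisotropic
  have hbm : b ∈ perp B a r := mem_perp_all.mpr h.orthogonal
  -- the values of `B x b` are equidistributed over `F`
  have key (f : F → ℂ) : (Fintype.card F : ℂ) * ∑ x : perp B a r, f (B x b) =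
      Fintype.card (perp B a r) * ∑ u, f u := by
    rw [average_line _ hbm (fun x => f (B x b))]
    have (x : perp B a r) : ∑ t : F, f (B (x + t • b) b) = ∑ u, f u := by
      refine Fintype.sum_equiv ((Equiv.mulRight₀ _ hb).trans (Equiv.addLeft (B x b))) _ _
        fun t => ?_
      simp
    simp only [this, Finset.sum_const, Finset.card_univ, nsmul_eq_mul]
  have e1 (x : perp B a r) : ψ (B x x) = ψ ((B b b)⁻¹ * (B x b) ^ 2) := by
    have := h.apply_mul hB x.2 x.2
    congr 1
    field_simp
    rw [this, sq]
  have e2 (x : perp B a r) : ψ (B x y) = ψ (B x b * (B y b * (B b b)⁻¹)) := by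
    have := h.apply_mul hB x.2 hy
    congr 1
    field_simp
    rw [this]
  have k1 := key (fun u => ψ ((B b b)⁻¹ * u ^ 2))
  have k2 := key (fun u => quadChar F u * ψ (u * (B y b * (B b b)⁻¹)))
  simp only [← e1, hG, sum_addChar_mul_sq h2 hψ (inv_ne_zero hb)] at k1
  simp only [← e2, sum_quadChar_mul_addChar h2, map_mul] at k2
  refine mul_left_cancel₀ hq ?_
  simp only [mul_assoc, ← Finset.mul_sum]
  rw [mul_left_comm, k2, ← mul_assoc _ G, k1]
  simp only [quadChar_inv]
  ring

/-- Each piece is an eigenvector of the Fourier transform, with eigenvalue `± G`. -/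
theorem IsIsotropicFlag.sum_flagSign_mul_addChar (h : IsIsotropicFlag B a b) (hB : B.IsSymm)
    (h2 : ringChar F ≠ 2) {ψ : AddChar F ℂ} (hψ : ψ.IsPrimitive) {G : ℂ}
    (hG : ∀ c : F, c ≠ 0 → ∑ x, ψ (c * B x x) = quadChar F c * G) (i : Option (Fin r)) :
    ∃ ε : ℤ, (ε = 1 ∨ ε = -1) ∧
      ∀ y, ∑ x, (flagSign B a b i x : ℂ) * ψ (B x y) = ε * G * flagSign B a b i y := by
  classical
  have hsub (U : Submodule F V) (f : V → ℂ) : ∑ x, (if x ∈ U then f x else 0) = ∑ x : U, f x := by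
    rw [← Finset.sum_filter]
    exact Finset.sum_subtype _ (by simp) _
  have hGp (n : ℕ) (hn : n ≤ r) (c : F) (hc : c ≠ 0) :
      ∑ x : perp B a n, ψ (c * B x x) = quadChar F c * G := by
    rw [sum_perp_quadratic hB h2 hψ h.isotropic hc hn, hG c hc]
  rcases i with _ | l
  · refine ⟨1, Or.inl rfl, fun y => ?_⟩
    by_cases hy : y ∈ perp B a r
    · have e1 : (flagSign B a b none y : ℂ) = quadChar F (B b b) * quadChar F (B y b) := by
        rw [flagSign, if_pos hy]
        simp [quadChar_apply]
      have hG1 := hGp r le_rfl 1 one_ne_zero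
      simp only [one_mul, map_one] at hG1
      rw [e1, Int.cast_one, one_mul, ← sum_perp_mul_addChar hB h2 hψ h hG1 hy,
        ← hsub _ (fun x => quadChar F (B b b) * quadChar F (B x b) * ψ (B x y))]
      refine Finset.sum_congr rfl fun x _ => ?_
      simp only [flagSign]
      split_ifs <;> simp [quadChar_apply]
    · rw [sum_mul_addChar_eq_zero hψ hB (fun k _ t x => by
        rw [(h.flagSign_add_smul hB k t x).2]) hy]
      simp [flagSign, hy]
  · refine ⟨quadraticChar F 2, quadraticChar_dichotomy (Ring.two_ne_zero h2), fun y => ?_⟩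
    by_cases hy : y ∈ perp B a l
    · have e1 : (flagSign B a b (some l) y : ℂ) =
          quadChar F (B y y) * quadChar F (B y (a l)) := by
        rw [flagSign, if_pos hy]
        simp [quadChar_apply]
      have hal : a l ∈ perp B a l := fun k _ => h.isotropic _ _
      rw [e1, ← quadChar_apply, ← sum_tangent_mul_addChar hB h2 hψ _ hal (h.isotropic _ _)
        (hGp l l.isLt.le) hy,
        ← hsub _ (fun x => quadChar F (B x x) * quadChar F (B x (a l)) * ψ (B x y))]
      refine Finset.sum_congr rfl fun x _ => ?_
      simp only [flagSign]
      split_ifs <;> simp [quadChar_apply]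
    · rw [sum_mul_addChar_eq_zero hψ hB (fun k hk t x => by
        rw [(h.flagSign_add_smul hB k t x).1 l hk]) hy]
      simp [flagSign, hy]

theorem IsIsotropicFlag.sum_flagSign_eq (h : IsIsotropicFlag B a b) (hB : B.IsSymm)
    (h2 : ringChar F ≠ 2) {ψ : AddChar F ℂ} (hψ : ψ.IsPrimitive) {G : ℂ}
    (hG : ∀ c : F, c ≠ 0 → ∑ x, ψ (c * B x x) = quadChar F c * G) (y : V) :
    (B y y = 0 → ∑ x, (∑ i, (flagSign B a b i x : ℂ)) * ψ (B x y) = 0) ∧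
      (B y y ≠ 0 → ∑ x, (∑ i, (flagSign B a b i x : ℂ)) * ψ (B x y) = G ∨
        ∑ x, (∑ i, (flagSign B a b i x : ℂ)) * ψ (B x y) = -G) := by
  choose ε hε hsum using h.sum_flagSign_mul_addChar hB h2 hψ hG
  have e : ∑ x, (∑ i, (flagSign B a b i x : ℂ)) * ψ (B x y) =
      ∑ i, (ε i : ℂ) * G * flagSign B a b i y := by
    simp only [Finset.sum_mul, ← hsum]
    exact Finset.sum_comm
  rw [e]
  constructor
  · intro hy
    simp [h.flagSign_eq_zero hB hy]
  · intro hy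
    obtain ⟨i, hi, hj⟩ := h.exists_flagSign hB hy
    rw [Finset.sum_eq_single i (fun j _ hne => by simp [hj j hne]) (by simp)]
    rcases hε i with h1 | h1 <;> rcases hi with h3 | h3 <;> simp [h1, h3]

end Eigenfunctions

/-! ### Existence of isotropic flags -/

section Counting

variable {F V : Type*} [Field F] [AddCommGroup V] [Module F V] {B : LinearMap.BilinForm F V} {r : ℕ}
  {a : Fin r → V} [Fintype F] [DecidableEq F] [Fintype V]

open Classical in
/-- Exactly one `|F|`-th of the vectors orthogonal to an isotropic family is isotropic, because the
Gaussian sums `∑ x, ψ (c * B x x)` over `c ≠ 0` cancel. -/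
theorem card_isotropic_mul_card (hB : B.IsSymm) (h2 : ringChar F ≠ 2) {ψ : AddChar F ℂ}
    (hψ : ψ.IsPrimitive) {G : ℂ}
    (hG : ∀ c : F, c ≠ 0 → ∑ x, ψ (c * B x x) = quadChar F c * G)
    (hiso : ∀ k l, B (a k) (a l) = 0) :
    (Finset.univ.filter fun x : perp B a r => B x x = 0).card * Fintype.card F =
      Fintype.card (perp B a r) := by
  have h1 : ∑ x : perp B a r, ∑ c, ψ (c * B x x) =
      (Finset.univ.filter fun x : perp B a r => B x x = 0).card * (Fintype.card F : ℂ) := by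
    simp only [sum_addChar_mul ψ hψ]
    rw [← Finset.sum_filter, Finset.sum_const, nsmul_eq_mul]
  have h3 (c : F) : ∑ x : perp B a r, ψ (c * B x x) =
      quadChar F c * G + if c = 0 then (Fintype.card (perp B a r) : ℂ) else 0 := by
    by_cases hc : c = 0
    · simp [hc, quadChar_zero]
    · rw [sum_perp_quadratic hB h2 hψ hiso hc le_rfl, hG c hc, if_neg hc, add_zero]
  rw [Finset.sum_comm] at h1
  simp only [h3, Finset.sum_add_distrib, ← Finset.sum_mul, sum_quadChar_eq_zero h2, zero_mul,
    zero_add, Finset.sum_ite_eq', Finset.mem_univ, if_true] at h1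
  exact_mod_cast h1.symm

theorem exists_anisotropic_perp (hB : B.IsSymm) (h2 : ringChar F ≠ 2) {ψ : AddChar F ℂ}
    (hψ : ψ.IsPrimitive) {G : ℂ}
    (hG : ∀ c : F, c ≠ 0 → ∑ x, ψ (c * B x x) = quadChar F c * G)
    (hiso : ∀ k l, B (a k) (a l) = 0) : ∃ b ∈ perp B a r, B b b ≠ 0 := by
  classical
  by_contra! hcon
  have hcard := card_isotropic_mul_card hB h2 hψ hG hiso
  rw [Finset.filter_true_of_mem fun (x : perp B a r) _ => hcon x x.2, Finset.card_univ] at hcard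
  have h1 : 0 < Fintype.card (perp B a r) := Fintype.card_pos
  have h3 := Fintype.one_lt_card (α := F)
  nlinarith

end Counting

section Existence

variable {F V : Type*} [Field F] [AddCommGroup V] [Module F V] [FiniteDimensional F V]
  {B : LinearMap.BilinForm F V} {r : ℕ} {a : Fin r → V} {b : V}

theorem finrank_perp (hB : B.IsSymm) (hnd : B.Nondegenerate) (ha : LinearIndependent F a) :
    Module.finrank F (perp B a r) = Module.finrank F V - r := by
  have h : perp B a r = B.orthogonal (Submodule.span F (Set.range a)) := by
    ext x
    rw [LinearMap.BilinForm.mem_orthogonal_iff, mem_perp_all]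
    constructor
    · intro hx n hn
      induction hn using Submodule.span_induction with
      | mem y hy =>
        obtain ⟨k, rfl⟩ := hy
        rw [← hB.eq]
        exact hx k
      | zero => simp
      | add y z _ _ hy hz => simp_all
      | smul c y _ hy => simp_all
    · intro hx k
      rw [← hB.eq]
      exact hx _ (Submodule.subset_span ⟨k, rfl⟩)
  rw [h, LinearMap.BilinForm.finrank_orthogonal hnd, finrank_span_eq_card ha, Fintype.card_fin]

/-- The dimension of `V` forces the orthogonal space of `a` to have dimension `r + 1`, so that it is
spanned by `a` and `b`. -/
theorem IsIsotropicFlag.of_linearIndependent (hB : B.IsSymm) (hnd : B.Nondegenerate)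
    (hV : Module.finrank F V = 2 * r + 1) (hiso : ∀ k l, B (a k) (a l) = 0)
    (hlin : LinearIndependent F a) (horth : ∀ k, B b (a k) = 0) (hb : B b b ≠ 0) :
    IsIsotropicFlag B a b := by
  refine ⟨hiso, horth, hb, fun x hx => ?_⟩
  have hspan : Submodule.span F (Set.range a) ≤ perp B a r :=
    Submodule.span_le.mpr (by
      rintro _ ⟨k, rfl⟩
      exact mem_perp_all.mpr (hiso k))
  have hbn : b ∉ Submodule.span F (Set.range a) := by
    intro hmem
    obtain ⟨c, hc⟩ := (Submodule.mem_span_range_iff_exists_fun F).mp hmem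
    refine hb ?_
    nth_rewrite 2 [← hc]
    simp [horth]
  have hli : LinearIndependent F (Fin.snoc a b : Fin (r + 1) → V) :=
    linearIndependent_finSnoc.mpr ⟨hlin, hbn⟩
  have hle : Submodule.span F (Set.range (Fin.snoc a b : Fin (r + 1) → V)) ≤ perp B a r := by
    rw [Submodule.span_le]
    rintro _ ⟨k, rfl⟩
    refine Fin.lastCases ?_ (fun k => ?_) k
    · simpa using mem_perp_all.mpr horth
    · simpa using mem_perp_all.mpr (hiso k)
  have heq := Submodule.eq_of_le_of_finrank_eq hle (by
    rw [finrank_perp hB hnd hlin, finrank_span_eq_card hli, Fintype.card_fin, hV]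
    omega)
  rw [← heq] at hx
  obtain ⟨c, hc⟩ := (Submodule.mem_span_range_iff_exists_fun F).mp hx
  refine ⟨fun i => c i.castSucc, c (Fin.last r), ?_⟩
  rw [← hc, Fin.sum_univ_castSucc]
  simp

variable [Fintype F] [DecidableEq F] [Fintype V]

/-- As long as `2 * n + 2 < finrank F V`, the isotropic vectors orthogonal to `n` independent
isotropic ones outnumber the span of these, so the family can be extended. -/
theorem exists_isotropic_family (hB : B.IsSymm) (hnd : B.Nondegenerate) (h2 : ringChar F ≠ 2)
    {ψ : AddChar F ℂ} (hψ : ψ.IsPrimitive) {G : ℂ}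
    (hG : ∀ c : F, c ≠ 0 → ∑ x, ψ (c * B x x) = quadChar F c * G) (n : ℕ)
    (hn : 2 * n < Module.finrank F V) :
    ∃ a : Fin n → V, (∀ k l, B (a k) (a l) = 0) ∧ LinearIndependent F a := by
  classical
  induction n with
  | zero => exact ⟨Fin.elim0, fun k => k.elim0, linearIndependent_empty_type⟩
  | succ n ih =>
    obtain ⟨a, hiso, hlin⟩ := ih (by omega)
    have hcard := card_isotropic_mul_card hB h2 hψ hG hiso
    rw [Module.card_eq_pow_finrank (K := F) (V := perp B a n), finrank_perp hB hnd hlin,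
      show Module.finrank F V - n = (Module.finrank F V - n - 1) + 1 by omega, pow_succ] at hcard
    have hcard' := Nat.eq_of_mul_eq_mul_right Fintype.card_pos hcard
    have hW : Fintype.card (Submodule.span F (Set.range a)) = Fintype.card F ^ n := by
      rw [Module.card_eq_pow_finrank (K := F), finrank_span_eq_card hlin, Fintype.card_fin]
    have hex : ∃ x ∈ perp B a n, B x x = 0 ∧ x ∉ Submodule.span F (Set.range a) := by
      by_contra! hcon
      have hle : (Finset.univ.filter fun x : perp B a n => B x x = 0).card ≤
          Fintype.card (Submodule.span F (Set.range a)) := by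
        rw [← Fintype.card_coe]
        refine Fintype.card_le_of_injective
          (fun x => ⟨x.1.1, hcon _ x.1.2 (Finset.mem_filter.mp x.2).2⟩) fun x y hxy => ?_
        exact Subtype.ext (Subtype.ext (congrArg (fun z => z.1) hxy))
      rw [hcard', hW] at hle
      have := (Nat.pow_le_pow_iff_right (Fintype.one_lt_card (α := F))).mp hle
      omega
    obtain ⟨x, hx, hxx, hxs⟩ := hex
    refine ⟨Fin.snoc a x, fun k l => ?_, linearIndependent_finSnoc.mpr ⟨hlin, hxs⟩⟩
    have hx' (l : Fin n) : B (a l) x = 0 := by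
      rw [← hB.eq]
      exact hx l l.isLt
    refine Fin.lastCases ?_ (fun k => ?_) k <;> refine Fin.lastCases ?_ (fun l => ?_) l
    · simpa using hxx
    · simpa using hx l l.isLt
    · simpa using hx' k
    · simpa using hiso k l

end Existence

/-! ### The trace form of an extension of odd degree -/

section TraceForm

variable {F K : Type*} [Field F] [Fintype F] [Field K] [Fintype K] [Algebra F K]

/-- By transitivity of the trace, the canonical character of `K` factors through the trace to
`F`. -/
theorem exists_compatible_addChar (p : ℕ) [Fact p.Prime] [Algebra (ZMod p) K] :
    ∃ ψ : AddChar F ℂ, ψ.IsPrimitive ∧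
      ∀ x : K, canonicalAddChar p K x = ψ (Algebra.trace F K x) := by
  have : CharP K p := charP_of_injective_algebraMap (algebraMap (ZMod p) K).injective p
  have : CharP F p := (RingHom.charP_iff (algebraMap F K) (algebraMap F K).injective p).mpr
    inferInstance
  let _ : Algebra (ZMod p) F := ZMod.algebra F p
  have : IsScalarTower (ZMod p) F K := IsScalarTower.of_algebraMap_eq' (Subsingleton.elim _ _)
  refine ⟨canonicalAddChar p F, AddChar.IsPrimitive.of_ne_one ?_, fun x => ?_⟩
  · rw [AddChar.ne_one_iff]
    have h1 : (ZMod.stdAddChar (N := p)) ≠ 1 := by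
      have := ZMod.isPrimitive_stdAddChar p (one_ne_zero (α := ZMod p))
      rwa [AddChar.mulShift_one] at this
    obtain ⟨t, ht⟩ := AddChar.ne_one_iff.mp h1
    obtain ⟨x, hx⟩ := Algebra.trace_surjective (ZMod p) F t
    refine ⟨x, ?_⟩
    change ZMod.stdAddChar (Algebra.trace (ZMod p) F x) ≠ 1
    rwa [hx]
  · change ZMod.stdAddChar (Algebra.trace (ZMod p) K x) =
      ZMod.stdAddChar (Algebra.trace (ZMod p) F (Algebra.trace F K x))
    rw [Algebra.trace_trace]

variable [DecidableEq F] [DecidableEq K]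

/-- In an extension of odd degree `m`, the norm `c ↦ c ^ m` detects squares of the base field. -/
theorem quadraticChar_algebraMap (hm : Odd (Module.finrank F K)) (c : F) :
    quadraticChar K (algebraMap F K c) = quadraticChar F c := by
  by_cases hc : c = 0
  · simp [hc]
  have hc' : algebraMap F K c ≠ 0 := by simpa using hc
  have hiff : IsSquare (algebraMap F K c) ↔ IsSquare c := by
    refine ⟨fun h => ?_, fun h => h.map _⟩
    have h1 := h.map (Algebra.norm F)
    rw [Algebra.norm_algebraMap] at h1
    obtain ⟨k, hk⟩ := hm
    rw [hk, pow_succ, pow_mul'] at h1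
    have h3 : IsSquare (c ^ k * c ^ k) := ⟨_, rfl⟩
    rw [sq] at h1
    have h4 := h1.div h3
    rwa [mul_div_cancel_left₀ _ (mul_ne_zero (pow_ne_zero _ hc) (pow_ne_zero _ hc))] at h4
  by_cases h : IsSquare c
  · rw [(quadraticChar_one_iff_isSquare hc).mpr h,
      (quadraticChar_one_iff_isSquare hc').mpr (hiff.mpr h)]
  · rw [quadraticChar_neg_one_iff_not_isSquare.mpr h,
      quadraticChar_neg_one_iff_not_isSquare.mpr (mt hiff.mp h)]

theorem sum_addChar_traceForm (h2 : ringChar F ≠ 2) (hm : Odd (Module.finrank F K)) (p : ℕ)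
    [Fact p.Prime] [Algebra (ZMod p) K] {ψ : AddChar F ℂ}
    (hψK : ∀ x : K, canonicalAddChar p K x = ψ (Algebra.trace F K x)) {c : F} (hc : c ≠ 0) :
    ∑ x : K, ψ (c * Algebra.traceForm F K x x) = quadChar F c * quadraticGaussSum p K := by
  have h2K : ringChar K ≠ 2 := by
    rwa [← Algebra.ringChar_eq F K]
  have hprim : (canonicalAddChar p K).IsPrimitive := by
    obtain ⟨φ, hφ, h⟩ := exists_compatible_addChar (F := K) (K := K) p
    have : canonicalAddChar p K = φ := by
      ext x
      rw [h]
      simp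
    rwa [this]
  have h := sum_addChar_mul_sq h2K hprim (c := algebraMap F K c) (by simpa using hc)
  rw [quadChar_apply, quadraticChar_algebraMap hm, ← quadChar_apply] at h
  refine Eq.trans ?_ h
  refine Finset.sum_congr rfl fun x _ => ?_
  rw [hψK, Algebra.traceForm_apply, ← Algebra.smul_def, map_smul, smul_eq_mul, sq]

end TraceForm

/-! ### The set `D` as a level set -/

section LevelSet

theorem mem_squareClass_iff {F : Type*} [Field F] [Fintype F] [DecidableEq F] {y : F} :
    y ∈ squareClass F ↔ quadraticChar F y = 1 := by
  by_cases hy : y = 0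
  · simp [squareClass, hy]
  · rw [quadraticChar_one_iff_isSquare hy]
    exact and_iff_right hy

theorem mem_nonsquareClass_iff {F : Type*} [Field F] [Fintype F] [DecidableEq F] {y : F} :
    y ∈ nonsquareClass F ↔ quadraticChar F y = -1 :=
  quadraticChar_neg_one_iff_not_isSquare.symm

variable {F K : Type*} [Field F] [Field K] [Algebra F K] {r : ℕ}
  {a : Fin r → K} {b : K}

/-- The hypothesis `0 < r` is needed for `b ≠ 0`, which `IsTangentChain` only records through the
membership in the sets `hyper F (a l)`. -/
theorem IsTangentChain.isIsotropicFlag [Finite F] [Finite K] (h : IsTangentChain F a b)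
    (hK : Module.finrank F K = 2 * r + 1) (hr : 0 < r) :
    IsIsotropicFlag (Algebra.traceForm F K) a b := by
  have hb := h.base_mem
  refine .of_linearIndependent (Algebra.traceForm_isSymm F) (traceForm_nondegenerate F K) hK
    (fun k l => ?_) h.linearIndependent (fun k => (Set.mem_iInter.mp hb.1 k).2) fun h0 => hb.2 ?_
  · rw [Algebra.traceForm_apply]
    rcases lt_trichotomy k l with hkl | rfl | hkl
    · rw [mul_comm]
      exact (h.mem_hyper k l hkl).2
    · rw [← sq]
      exact (h.mem_quadric k).2
    · exact (h.mem_hyper l k hkl).2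
  · rw [Algebra.traceForm_apply, ← sq] at h0
    exact ⟨(Set.mem_iInter.mp hb.1 ⟨0, hr⟩).1, h0⟩

theorem IsIsotropicFlag.isTangentChain (h : IsIsotropicFlag (Algebra.traceForm F K) a b)
    (hlin : LinearIndependent F a) : IsTangentChain F a b := by
  have hb0 : b ≠ 0 := by
    rintro rfl
    exact h.anisotropic (by simp)
  refine ⟨fun l => ⟨hlin.ne_zero l, ?_⟩, fun k l _ => ⟨hlin.ne_zero l, h.isotropic l k⟩, hlin,
    Set.mem_iInter.mpr fun l => ⟨hb0, h.orthogonal l⟩, fun hq => h.anisotropic ?_⟩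
  · rw [sq]
    exact h.isotropic l l
  · rw [Algebra.traceForm_apply, ← sq]
    exact hq.2

variable [Fintype F] [DecidableEq F]

theorem mem_setT_iff {l : Fin r} {x : K} :
    x ∈ setT F a l ↔ flagSign (Algebra.traceForm F K) a b (some l) x = 1 := by
  by_cases hx0 : x = 0
  · subst hx0
    simp [setT, quadricSq, quadricNsq, flagSign]
  have hmem : (x ∈ ⋂ k, ⋂ (_ : k < l), hyper F (a k)) ↔ x ∈ perp (Algebra.traceForm F K) a l := by
    simp [mem_perp, hyper, hx0, Algebra.traceForm_apply]
  simp only [setT, Set.mem_union, Set.mem_inter_iff, hmem, quadricSq, quadricNsq, hyperSq, hyperNsq,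
    Set.mem_ofPred_eq, mem_squareClass_iff, mem_nonsquareClass_iff, ne_eq, hx0, not_false_eq_true,
    true_and, flagSign, Algebra.traceForm_apply, sq]
  split_ifs with h
  · simp [h, Int.mul_eq_one_iff_eq_one_or_neg_one]
  · simp [h]

theorem IsIsotropicFlag.mem_setB_iff (h : IsIsotropicFlag (Algebra.traceForm F K) a b) {x : K} :
    x ∈ setB F a b ↔ flagSign (Algebra.traceForm F K) a b none x = 1 := by
  have key (c : Fin r → F) (y : F) :
      flagSign (Algebra.traceForm F K) a b none (∑ i, c i • a i + y • b) = quadraticChar F y := by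
    have hab (i : Fin r) : Algebra.traceForm F K (a i) b = 0 := by
      rw [← (Algebra.traceForm_isSymm F).eq]
      exact h.orthogonal i
    have hm : ∑ i, c i • a i + y • b ∈ perp (Algebra.traceForm F K) a r := by
      rw [mem_perp_all]
      intro k
      simp [h.isotropic, h.orthogonal, -Algebra.traceForm_apply]
    have hv : Algebra.traceForm F K (∑ i, c i • a i + y • b) b =
        y * Algebra.traceForm F K b b := by
      simp [hab, -Algebra.traceForm_apply]
    rw [flagSign, if_pos hm, hv, map_mul]
    linear_combination quadraticChar F y * quadraticChar_sq_one h.anisotropic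
  constructor
  · rintro ⟨c, y, hy, rfl⟩
    rw [key]
    exact mem_squareClass_iff.mp hy
  · intro hx
    have hm : x ∈ perp (Algebra.traceForm F K) a r := by
      by_contra hm
      simp [flagSign, hm] at hx
    obtain ⟨c, y, rfl⟩ := h.exists_coords x hm
    exact ⟨c, y, mem_squareClass_iff.mpr ((key c y).symm.trans hx), rfl⟩

theorem IsIsotropicFlag.mem_setD_iff (h : IsIsotropicFlag (Algebra.traceForm F K) a b) {x : K} :
    x ∈ setD F a b ↔ ∃ i, flagSign (Algebra.traceForm F K) a b i x = 1 := by
  rw [setD, Set.mem_union, Set.mem_iUnion, h.mem_setB_iff, Option.exists, or_comm]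
  simp only [mem_setT_iff (b := b)]

theorem IsIsotropicFlag.trace_sq_ne_zero_of_mem_setD
    (h : IsIsotropicFlag (Algebra.traceForm F K) a b) {x : K} (hx : x ∈ setD F a b) :
    Algebra.trace F K (x ^ 2) ≠ 0 := by
  obtain ⟨i, hi⟩ := h.mem_setD_iff.mp hx
  intro h0
  rw [sq] at h0
  rw [h.flagSign_eq_zero (Algebra.traceForm_isSymm F) h0 i] at hi
  exact zero_ne_one hi

theorem IsIsotropicFlag.smul_mem_setD_iff_of_isSquare
    (h : IsIsotropicFlag (Algebra.traceForm F K) a b) {s : F} (hs : s ≠ 0) (hsq : IsSquare s)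
    {x : K} : s • x ∈ setD F a b ↔ x ∈ setD F a b := by
  simp only [h.mem_setD_iff, flagSign_smul _ hs, (quadraticChar_one_iff_isSquare hs).mpr hsq,
    one_mul]

theorem IsIsotropicFlag.smul_mem_setD_iff_of_not_isSquare
    (h : IsIsotropicFlag (Algebra.traceForm F K) a b) {s : F} (hs : ¬ IsSquare s) {x : K}
    (hx : Algebra.trace F K (x ^ 2) ≠ 0) : s • x ∈ setD F a b ↔ x ∉ setD F a b := by
  have hs0 : s ≠ 0 := by
    rintro rfl
    exact hs (IsSquare.zero)
  rw [sq] at hx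
  obtain ⟨i, hi, hj⟩ := h.exists_flagSign (Algebra.traceForm_isSymm F) hx
  have huniq (c : ℤ) (hc : c ≠ 0) : (∃ j, flagSign (Algebra.traceForm F K) a b j x = c) ↔
      flagSign (Algebra.traceForm F K) a b i x = c := by
    refine ⟨fun ⟨j, hjc⟩ => ?_, fun e => ⟨i, e⟩⟩
    by_cases hij : j = i
    · rwa [← hij]
    · exact absurd ((hj j hij).symm.trans hjc).symm hc
  simp only [h.mem_setD_iff, flagSign_smul _ hs0, quadraticChar_neg_one_iff_not_isSquare.mpr hs,
    neg_one_mul, neg_eq_iff_eq_neg, huniq _ (neg_ne_zero.mpr one_ne_zero), huniq _ one_ne_zero]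
  rcases hi with e | e <;> rw [e] <;> decide

/-- The sum of the pieces is `1` on `D`, `-1` on its nonsquare multiples, and `0` on the isotropic
vectors. -/
theorem IsIsotropicFlag.sum_flagSign (h : IsIsotropicFlag (Algebra.traceForm F K) a b)
    [DecidablePred (· ∈ setD F a b)] (x : K) :
    ∑ i, (flagSign (Algebra.traceForm F K) a b i x : ℂ) =
      2 * (if x ∈ setD F a b then 1 else 0) - if Algebra.trace F K (x ^ 2) ≠ 0 then 1 else 0 := by
  by_cases hx : Algebra.trace F K (x ^ 2) = 0
  · have hx' := hx
    rw [sq] at hx'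
    have hD : x ∉ setD F a b := fun hD => h.trace_sq_ne_zero_of_mem_setD hD hx
    simp [hD, hx, h.flagSign_eq_zero (Algebra.traceForm_isSymm F) hx']
  · have hx' := hx
    rw [sq] at hx'
    obtain ⟨i, hi, hj⟩ := h.exists_flagSign (Algebra.traceForm_isSymm F) hx'
    rw [Finset.sum_eq_single i (fun j _ hne => by simp [hj j hne]) (by simp)]
    have hD : x ∈ setD F a b ↔ flagSign (Algebra.traceForm F K) a b i x = 1 := by
      rw [h.mem_setD_iff]
      refine ⟨fun ⟨j, hjc⟩ => ?_, fun e => ⟨i, e⟩⟩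
      by_cases hij : j = i
      · rwa [← hij]
      · rw [hj j hij] at hjc
        exact absurd hjc zero_ne_one
    rcases hi with e | e
    · simp only [hD, e, hx, ne_eq, not_false_eq_true, if_true]
      norm_num
    · simp only [hD, e, hx, ne_eq, not_false_eq_true, if_true]
      norm_num

end LevelSet

/-! ### Cyclotomic classes and exponents of a primitive element -/

section Exponents

variable {K : Type*} [Field K] (ω : Kˣ)

theorem mem_cyclotomicClass_iff {M : ℕ} [NeZero M] {i : ZMod M} {x : K} :
    x ∈ cyclotomicClass ω M i ↔ ∃ z : ℤ, (z : ZMod M) = i ∧ x = ((ω ^ z : Kˣ) : K) := by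
  constructor
  · rintro ⟨k, rfl⟩
    refine ⟨i.val + M * k, by simp, ?_⟩
    rw [zpow_add, zpow_mul, zpow_natCast, zpow_natCast]
  · rintro ⟨z, rfl, rfl⟩
    refine ⟨z / M, ?_⟩
    congr 1
    rw [← zpow_natCast, ← zpow_natCast, ← zpow_mul, ← zpow_add, ZMod.val_intCast,
      Int.emod_add_mul_ediv]

variable {ω}

theorem exists_zpow_eq (hω : ∀ x : Kˣ, x ∈ Subgroup.zpowers ω) {x : K} (hx : x ≠ 0) :
    ∃ z : ℤ, x = ((ω ^ z : Kˣ) : K) := by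
  obtain ⟨z, hz⟩ := Subgroup.mem_zpowers_iff.mp (hω (Units.mk0 x hx))
  exact ⟨z, by simp [hz]⟩

theorem zpow_mem_iff_of_intCast_eq {M : ℕ} {D : Set K}
    (hper : ∀ (k z : ℤ), ((ω ^ (z + M * k) : Kˣ) : K) ∈ D ↔ ((ω ^ z : Kˣ) : K) ∈ D) {z z' : ℤ}
    (h : (z : ZMod M) = z') : ((ω ^ z : Kˣ) : K) ∈ D ↔ ((ω ^ z' : Kˣ) : K) ∈ D := by
  obtain ⟨k, hk⟩ := (ZMod.intCast_eq_intCast_iff_dvd_sub _ _ _).mp h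
  rw [show z' = z + M * k by omega, hper]

theorem intCast_mem_classIndices {M : ℕ} [NeZero M] {D : Set K}
    (hper : ∀ (k z : ℤ), ((ω ^ (z + M * k) : Kˣ) : K) ∈ D ↔ ((ω ^ z : Kˣ) : K) ∈ D) {z : ℤ} :
    (z : ZMod M) ∈ classIndices ω M D ↔ ((ω ^ z : Kˣ) : K) ∈ D := by
  constructor
  · intro h
    exact h ((mem_cyclotomicClass_iff ω).mpr ⟨z, rfl, rfl⟩)
  · intro h x hx
    obtain ⟨z', hz', rfl⟩ := (mem_cyclotomicClass_iff ω).mp hx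
    exact (zpow_mem_iff_of_intCast_eq hper hz').mpr h

theorem eq_iUnion_cyclotomicClass (hω : ∀ x : Kˣ, x ∈ Subgroup.zpowers ω) {M : ℕ} [NeZero M]
    {D : Set K} (h0 : (0 : K) ∉ D) {Y : Set (ZMod M)}
    (hY : ∀ z : ℤ, (z : ZMod M) ∈ Y ↔ ((ω ^ z : Kˣ) : K) ∈ D) :
    D = ⋃ t ∈ Y, cyclotomicClass ω M t := by
  ext x
  simp only [Set.mem_iUnion, mem_cyclotomicClass_iff, exists_prop]
  constructor
  · intro hx
    obtain ⟨z, rfl⟩ := exists_zpow_eq hω (ne_of_mem_of_not_mem hx h0)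
    exact ⟨z, (hY z).mpr hx, z, rfl, rfl⟩
  · rintro ⟨_, ht, z, rfl, rfl⟩
    exact (hY z).mp ht

theorem mem_halve_iff {N : ℕ} (hN : Odd N) {S : Set (ZMod N)} {j : ZMod N} :
    j ∈ halve S ↔ 2 * j ∈ S := by
  have hu : IsUnit (2 : ZMod N) := by
    have := (ZMod.isUnit_iff_coprime 2 N).mpr (Nat.coprime_two_left.mpr hN)
    exact_mod_cast this
  have h1 : (2 : ZMod N) * 2⁻¹ = 1 := ZMod.mul_inv_of_unit _ hu
  constructor
  · rintro ⟨i, hi, rfl⟩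
    simpa only [← mul_assoc, h1, one_mul] using hi
  · intro h
    exact ⟨_, h, by linear_combination j * h1⟩

theorem two_mul_val_intCast {N : ℕ} [NeZero N] (z : ℤ) :
    (2 * ((z : ZMod N).val : ZMod (2 * N))) = ((2 * z : ℤ) : ZMod (2 * N)) := by
  have h : (2 * ((z : ZMod N).val : ZMod (2 * N))) =
      ((2 * ((z : ZMod N).val : ℤ) : ℤ) : ZMod (2 * N)) := by push_cast; rfl
  rw [h, ZMod.intCast_eq_intCast_iff_dvd_sub, ZMod.val_intCast]
  refine ⟨z / N, ?_⟩
  have := Int.emod_add_mul_ediv z N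
  push_cast
  linear_combination (-2 : ℤ) * this

theorem intCast_eq_or_eq_add {N : ℕ} {z z' : ℤ} (h : (z : ZMod N) = z') :
    (z : ZMod (2 * N)) = z' ∨ (z : ZMod (2 * N)) = ((z' + N : ℤ) : ZMod (2 * N)) := by
  obtain ⟨k, hk⟩ := (ZMod.intCast_eq_intCast_iff_dvd_sub _ _ _).mp h
  rcases Int.even_or_odd' k with ⟨t, rfl | rfl⟩
  · left
    rw [ZMod.intCast_eq_intCast_iff_dvd_sub]
    exact ⟨t, by push_cast; linear_combination hk⟩
  · right
    rw [ZMod.intCast_eq_intCast_iff_dvd_sub]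
    exact ⟨t + 1, by push_cast; linear_combination hk⟩

/-- Suppose that membership in `X` of the class of `z` modulo `2 * N` alternates under `z ↦ z + N`
when `2 * z` is outside `I` modulo `N`, and fails otherwise. Then `X` reduces bijectively onto the
complement of `2⁻¹ I`. -/
theorem bijOn_cast_of_alternating {N : ℕ} (hN : Odd N) {X : Set (ZMod (2 * N))} {I : Set (ZMod N)}
    (hmem : ∀ z : ℤ, (z : ZMod (2 * N)) ∈ X → ((2 * z : ℤ) : ZMod N) ∉ I)
    (halt : ∀ z : ℤ, ((2 * z : ℤ) : ZMod N) ∉ I →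
      (((z + N : ℤ) : ZMod (2 * N)) ∈ X ↔ (z : ZMod (2 * N)) ∉ X)) :
    Set.BijOn (ZMod.cast : ZMod (2 * N) → ZMod N) X (halve I)ᶜ := by
  have hcast (z : ℤ) : (ZMod.cast (z : ZMod (2 * N)) : ZMod N) = z :=
    ZMod.cast_intCast (Dvd.intro_left 2 rfl) z
  refine ⟨fun t ht => ?_, fun t ht t' ht' h => ?_, fun i hi => ?_⟩
  · obtain ⟨z, rfl⟩ := ZMod.intCast_surjective t
    rw [hcast, Set.mem_compl_iff, mem_halve_iff hN]
    exact_mod_cast hmem z ht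
  · obtain ⟨z, rfl⟩ := ZMod.intCast_surjective t
    obtain ⟨z', rfl⟩ := ZMod.intCast_surjective t'
    rw [hcast, hcast] at h
    rcases intCast_eq_or_eq_add h with h' | h'
    · exact h'
    · rw [h'] at ht
      exact absurd ht' ((halt z' (hmem z' ht')).mp ht)
  · obtain ⟨z, rfl⟩ := ZMod.intCast_surjective i
    rw [Set.mem_compl_iff, mem_halve_iff hN] at hi
    have hi' : ((2 * z : ℤ) : ZMod N) ∉ I := by exact_mod_cast hi
    by_cases hz : (z : ZMod (2 * N)) ∈ X
    · exact ⟨z, hz, hcast z⟩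
    · exact ⟨_, (halt z hi').mpr hz, by rw [hcast]; simp⟩

/-- Splitting the indices by parity: the part `P₁` consists of the `4 * z` with `2 * z` in `X`, and
the part `P₂` of the `4 * z` with `2 * z + N` in `X`. -/
theorem exists_partition_of_alternating {N : ℕ} (hN : Odd N) {X : Set (ZMod (2 * N))}
    {I : Set (ZMod N)}
    (hmem : ∀ z : ℤ, (z : ZMod (2 * N)) ∈ X → ((2 * z : ℤ) : ZMod N) ∉ I)
    (halt : ∀ z : ℤ, ((2 * z : ℤ) : ZMod N) ∉ I →
      (((z + N : ℤ) : ZMod (2 * N)) ∈ X ↔ (z : ZMod (2 * N)) ∉ X)) :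
    ∃ P₁ P₂ : Set (ZMod N), Disjoint P₁ P₂ ∧ P₁ ∪ P₂ = Iᶜ ∧ X = liftPartition P₁ P₂ := by
  have : NeZero N := ⟨hN.pos.ne'⟩
  have hu : IsUnit (4 : ZMod N) := by
    have h := (ZMod.isUnit_iff_coprime 4 N).mpr
      (show Nat.Coprime (2 ^ 2) N from (Nat.coprime_two_left.mpr hN).pow_left 2)
    exact_mod_cast h
  have h4 : (4 : ZMod N) * 4⁻¹ = 1 := ZMod.mul_inv_of_unit _ hu
  -- `u i` is the index `2 * (4⁻¹ * i)` modulo `2 * N`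
  let u : ZMod N → ZMod (2 * N) := fun i => 2 * ((4⁻¹ * i).val : ZMod (2 * N))
  have hu4 (z : ℤ) : u ((2 * (2 * z) : ℤ) : ZMod N) = ((2 * z : ℤ) : ZMod (2 * N)) := by
    rw [← two_mul_val_intCast]
    simp only [u]
    congr 4
    push_cast
    linear_combination (z : ZMod N) * h4
  have hsurj (i : ZMod N) : ∃ z : ℤ, i = ((2 * (2 * z) : ℤ) : ZMod N) := by
    obtain ⟨z, hz⟩ := ZMod.intCast_surjective (4⁻¹ * i)
    refine ⟨z, ?_⟩
    push_cast
    rw [hz]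
    linear_combination (-i) * h4
  have hlift (P : Set (ZMod N)) (z : ℤ) :
      (z : ZMod N) ∈ halve (halve P) ↔ ((2 * (2 * z) : ℤ) : ZMod N) ∈ P := by
    rw [mem_halve_iff hN, mem_halve_iff hN]
    push_cast
    rfl
  refine ⟨{i | u i ∈ X}, {i | u i + N ∈ X}, ?_, ?_, ?_⟩
  · rw [Set.disjoint_left]
    intro i h1 h2
    obtain ⟨z, rfl⟩ := hsurj i
    simp only [Set.mem_ofPred_eq, hu4] at h1 h2
    exact (halt _ (hmem _ h1)).mp (by exact_mod_cast h2) h1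
  · ext i
    obtain ⟨z, rfl⟩ := hsurj i
    simp only [Set.mem_union, Set.mem_ofPred_eq, hu4, Set.mem_compl_iff]
    have hcast : ((2 * z : ℤ) : ZMod (2 * N)) + N = ((2 * z + N : ℤ) : ZMod (2 * N)) := by
      push_cast
      rfl
    rw [hcast]
    constructor
    · rintro (h | h)
      · exact hmem _ h
      · have h' := hmem _ h
        have e : ((2 * (2 * z + N) : ℤ) : ZMod N) = ((2 * (2 * z) : ℤ) : ZMod N) := by simp
        rwa [e] at h'
    · intro h
      have := halt _ h
      tauto
  · ext t
    simp only [liftPartition, Set.mem_union, Set.mem_image]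
    constructor
    · intro ht
      obtain ⟨w, rfl⟩ := ZMod.intCast_surjective t
      obtain ⟨n, hn⟩ := hN
      rcases Int.even_or_odd' w with ⟨z, rfl | rfl⟩
      · refine Or.inl ⟨z, ?_, two_mul_val_intCast z⟩
        rw [hlift, Set.mem_ofPred_eq, hu4]
        exact ht
      · have e : 2 * (((z - n : ℤ) : ZMod N).val : ZMod (2 * N)) + N =
            ((2 * z + 1 : ℤ) : ZMod (2 * N)) := by
          rw [two_mul_val_intCast, ← Int.cast_natCast (R := ZMod (2 * N)) N, ← Int.cast_add]
          congr 1
          omega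
        refine Or.inr ⟨((z - n : ℤ) : ZMod N), ?_, e⟩
        rw [hlift, Set.mem_ofPred_eq, hu4, ← two_mul_val_intCast, e]
        exact ht
    · rintro (⟨j, hj, rfl⟩ | ⟨j, hj, rfl⟩)
      · obtain ⟨z, rfl⟩ := ZMod.intCast_surjective j
        rw [hlift, Set.mem_ofPred_eq, hu4] at hj
        rwa [two_mul_val_intCast]
      · obtain ⟨z, rfl⟩ := ZMod.intCast_surjective j
        rw [hlift, Set.mem_ofPred_eq, hu4] at hj
        rwa [two_mul_val_intCast]

end Exponents

/-! ### Character sums over multiples of `D` -/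

section CharacterSums

variable {K : Type*} [Field K] [Fintype K]

open Classical in
theorem charSum_smul (ψ : AddChar K ℂ) {u : K} (hu : u ≠ 0) (S : Set K) :
    charSum ψ (u • S) = ∑ x, if x ∈ S then ψ (u * x) else 0 := by
  rw [charSum, Finset.sum_filter]
  refine (Fintype.sum_equiv (Equiv.mulLeft₀ u hu) _ _ fun x => ?_).symm
  have h : u * x ∈ u • S ↔ x ∈ S := Set.smul_mem_smul_set_iff₀ hu S x
  by_cases hx : x ∈ S
  · simp [hx, h]
  · simp [hx, h]

variable {F : Type*} [Field F] [Fintype F] [DecidableEq F] [Algebra F K] {r : ℕ} {a : Fin r → K}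
  {b : K}

theorem IsIsotropicFlag.two_mul_charSum_sub_charSum
    (h : IsIsotropicFlag (Algebra.traceForm F K) a b) {φ : AddChar K ℂ} {ψ : AddChar F ℂ}
    (hφ : ∀ x : K, φ x = ψ (Algebra.trace F K x)) {y : K} (hy : y ≠ 0) :
    2 * charSum φ (y • setD F a b) - charSum φ (y • {x | Algebra.trace F K (x ^ 2) ≠ 0}) =
      ∑ x, (∑ i, (flagSign (Algebra.traceForm F K) a b i x : ℂ)) *
        ψ (Algebra.traceForm F K x y) := by
  classical
  rw [charSum_smul φ hy, charSum_smul φ hy, Finset.mul_sum, ← Finset.sum_sub_distrib]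
  refine Finset.sum_congr rfl fun x _ => ?_
  rw [h.sum_flagSign, Algebra.traceForm_apply, mul_comm x y, ← hφ, sub_mul, mul_assoc, ite_mul,
    ite_mul, one_mul, zero_mul]
  congr

end CharacterSums

/-! ### The norm of a primitive element -/

section Norm

variable {F K : Type*} [Field F] [Field K] [Finite K] [Algebra F K]

theorem algebraMap_norm_eq_zpow {N : ℕ} (hN : N = (Nat.card K - 1) / (Nat.card F - 1)) (ω : Kˣ) :
    algebraMap F K (Algebra.norm F (ω : K)) = ((ω ^ (N : ℤ) : Kˣ) : K) := by
  rw [FiniteField.algebraMap_norm_eq_pow, hN, zpow_natCast, Units.val_pow_eq_pow_val]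

theorem norm_ne_zero_of_unit (ω : Kˣ) : Algebra.norm F (ω : K) ≠ 0 :=
  Algebra.norm_ne_zero_iff.mpr ω.ne_zero

theorem zpow_add_mul_eq_smul {N : ℕ} (hN : N = (Nat.card K - 1) / (Nat.card F - 1)) (ω : Kˣ)
    (z k : ℤ) : ((ω ^ (z + N * k) : Kˣ) : K) =
      (Algebra.norm F (ω : K)) ^ k • ((ω ^ z : Kˣ) : K) := by
  rw [Algebra.smul_def, map_zpow₀, algebraMap_norm_eq_zpow hN, ← Units.val_zpow_eq_zpow_val,
    ← Units.val_mul, ← zpow_mul, ← zpow_add, add_comm]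

/-- The norm of a primitive element is its power with the odd exponent `N`. If it were a square,
then the primitive element, and with it every element of `K`, would be a square. -/
theorem not_isSquare_norm [Finite F] {N : ℕ} (hN : N = (Nat.card K - 1) / (Nat.card F - 1))
    (hNodd : Odd N) (h2 : ringChar F ≠ 2) {ω : Kˣ} (hω : ∀ x : Kˣ, x ∈ Subgroup.zpowers ω) :
    ¬ IsSquare (Algebra.norm F (ω : K)) := by
  intro h
  have h2K : ringChar K ≠ 2 := by rwa [← Algebra.ringChar_eq F K]
  obtain ⟨x, hx⟩ := FiniteField.exists_nonsquare h2K
  have hx0 : x ≠ 0 := by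
    rintro rfl
    exact hx IsSquare.zero
  obtain ⟨z, rfl⟩ := exists_zpow_eq hω hx0
  have h1 := h.map (algebraMap F K)
  rw [algebraMap_norm_eq_zpow hN] at h1
  have e : ω ^ (N : ℤ) = ω * (ω ^ (N / 2)) ^ 2 := by
    rw [← pow_mul, ← pow_succ', zpow_natCast]
    congr 1
    obtain ⟨k, hk⟩ := hNodd
    omega
  have hω' : IsSquare (ω : K) := by
    rw [e, Units.val_mul, Units.val_pow_eq_pow_val] at h1
    have h3 := h1.div (IsSquare.sq ((ω ^ (N / 2) : Kˣ) : K))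
    rwa [mul_div_cancel_right₀ _ (pow_ne_zero _ (Units.ne_zero _))] at h3
  refine hx ?_
  rw [Units.val_zpow_eq_zpow_val]
  exact hω'.zpow z

theorem trace_zpow_add_eq_zero_iff {N : ℕ} (hN : N = (Nat.card K - 1) / (Nat.card F - 1)) (ω : Kˣ)
    (z k : ℤ) : Algebra.trace F K ((ω ^ (z + N * k) : Kˣ) : K) = 0 ↔
      Algebra.trace F K ((ω ^ z : Kˣ) : K) = 0 := by
  rw [zpow_add_mul_eq_smul hN, map_smul, smul_eq_zero,
    or_iff_right (zpow_ne_zero _ (norm_ne_zero_of_unit ω))]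

theorem intCast_mem_singerSet_iff {N : ℕ} [NeZero N]
    (hN : N = (Nat.card K - 1) / (Nat.card F - 1)) (ω : Kˣ) (z : ℤ) :
    (z : ZMod N) ∈ singerSet F ω N ↔ Algebra.trace F K ((ω ^ z : Kˣ) : K) = 0 := by
  rw [singerSet, Set.mem_ofPred_eq, ← zpow_natCast, ZMod.val_intCast,
    ← trace_zpow_add_eq_zero_iff hN ω _ (z / N), Int.emod_add_mul_ediv]

end Norm

end SingerComplement

open SingerComplement in
theorem theorem7 {F K : Type*} [Field F] [Fintype F] [Field K] [Fintype K] [DecidableEq K]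
    [Algebra F K] (p : ℕ) [Fact p.Prime] [Algebra (ZMod p) K]
    (q m N : ℕ) (hq : Fintype.card F = q) (hq_odd : Odd q)
    (hm : Module.finrank F K = m) (hm_odd : Odd m) (hm_gt : 1 < m)
    (hN : N = (q ^ m - 1) / (q - 1))
    (ω : Kˣ) (hω : ∀ x : Kˣ, x ∈ Subgroup.zpowers ω) :
    -- the chain of tangent hyperplanes can be chosen
    (∃ (a : Fin ((m - 1) / 2) → K) (b : K), IsTangentChain F a b) ∧
    -- and for every choice, with `X` the index set of the classes contained in `D`:
    ∀ (a : Fin ((m - 1) / 2) → K) (b : K), IsTangentChain F a b →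
      ∀ X : Set (ZMod (2 * N)), X = classIndices ω (2 * N) (setD F a b) →
        -- `D` is the union of the classes of order `2 * N` indexed by `X`
        (setD F a b = ⋃ t ∈ X, cyclotomicClass ω (2 * N) t) ∧
        -- `X` reduces bijectively modulo `N` to the complement of `2⁻¹ I`
        Set.BijOn (ZMod.cast : ZMod (2 * N) → ZMod N) X (halve (singerSet F ω N))ᶜ ∧
        -- `X` arises from a partition of the complement of `I`
        (∃ T₁ T₂ : Set (ZMod N), Disjoint T₁ T₂ ∧ T₁ ∪ T₂ = (singerSet F ω N)ᶜ ∧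
          X = liftPartition T₁ T₂) ∧
        -- the two-valued character condition
        ∀ c : ℤ,
          ((c : ZMod N) ∈ halve (singerSet F ω N) →
            combinedSum p ω N X (halve (singerSet F ω N))ᶜ c = 0) ∧
          ((c : ZMod N) ∉ halve (singerSet F ω N) →
            combinedSum p ω N X (halve (singerSet F ω N))ᶜ c = quadraticGaussSum p K ∨
            combinedSum p ω N X (halve (singerSet F ω N))ᶜ c = -quadraticGaussSum p K) := by
  classical
  subst hq
  subst hm
  set m := Module.finrank F K with hm
  set r := (m - 1) / 2 with hr
  have hmr : m = 2 * r + 1 := by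
    obtain ⟨k, hk⟩ := hm_odd
    omega
  have hr0 : 0 < r := by omega
  have h2 : ringChar F ≠ 2 := by
    intro h
    have := FiniteField.even_card_of_char_two h
    rw [Nat.odd_iff] at hq_odd
    omega
  have hN' : N = (Nat.card K - 1) / (Nat.card F - 1) := by
    rw [hN, Nat.card_eq_fintype_card, Nat.card_eq_fintype_card,
      Module.card_eq_pow_finrank (K := F) (V := K)]
  have hNodd : Odd N := by
    rw [hN, ← Nat.geomSum_eq Fintype.one_lt_card, Finset.odd_sum_iff_odd_card_odd]
    simpa [hq_odd.pow] using hm_odd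
  have : NeZero N := ⟨hNodd.pos.ne'⟩
  have hsymm : (Algebra.traceForm F K).IsSymm := Algebra.traceForm_isSymm F
  obtain ⟨ψ, hψ, hψK⟩ := exists_compatible_addChar (F := F) (K := K) p
  have hG : ∀ c : F, c ≠ 0 → ∑ x : K, ψ (c * Algebra.traceForm F K x x) =
      quadChar F c * quadraticGaussSum p K :=
    fun c hc => sum_addChar_traceForm h2 hm_odd p hψK hc
  refine ⟨?_, fun a b hab X hX => ?_⟩
  · obtain ⟨a, hiso, hlin⟩ := exists_isotropic_family hsymm (traceForm_nondegenerate F K) h2 hψ hG r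
      (by omega)
    obtain ⟨b, hb, hbb⟩ := exists_anisotropic_perp hsymm h2 hψ hG hiso
    exact ⟨a, b, (IsIsotropicFlag.of_linearIndependent hsymm (traceForm_nondegenerate F K) hmr hiso
      hlin (mem_perp_all.mp hb) hbb).isTangentChain hlin⟩
  have hflag := hab.isIsotropicFlag hmr hr0
  set δ := Algebra.norm F (ω : K) with hδ
  have hδ0 : δ ≠ 0 := norm_ne_zero_of_unit ω
  have hδsq : ¬ IsSquare δ := not_isSquare_norm hN' hNodd h2 hω
  have hδω (z k : ℤ) : ((ω ^ (z + N * k) : Kˣ) : K) = δ ^ k • ((ω ^ z : Kˣ) : K) :=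
    zpow_add_mul_eq_smul hN' ω z k
  -- `D` is stable under the squares of `F`, among them the powers of `ω ^ (2 * N)`
  have hper (k z : ℤ) : ((ω ^ (z + (2 * N : ℕ) * k) : Kˣ) : K) ∈ setD F a b ↔
      ((ω ^ z : Kˣ) : K) ∈ setD F a b := by
    rw [show z + (2 * N : ℕ) * k = z + N * (k + k) by push_cast; ring, hδω,
      hflag.smul_mem_setD_iff_of_isSquare (zpow_ne_zero _ hδ0) ⟨δ ^ k, zpow_add₀ hδ0 k k⟩]
  have hXmem (z : ℤ) : (z : ZMod (2 * N)) ∈ X ↔ ((ω ^ z : Kˣ) : K) ∈ setD F a b := by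
    rw [hX]
    exact intCast_mem_classIndices hper
  have hI (z : ℤ) : ((2 * z : ℤ) : ZMod N) ∈ singerSet F ω N ↔
      Algebra.trace F K (((ω ^ z : Kˣ) : K) ^ 2) = 0 := by
    rw [intCast_mem_singerSet_iff hN', ← Units.val_pow_eq_pow_val, ← zpow_natCast, ← zpow_mul,
      mul_comm]
    rfl
  have hhalve (z : ℤ) : (z : ZMod N) ∈ halve (singerSet F ω N) ↔
      Algebra.trace F K (((ω ^ z : Kˣ) : K) ^ 2) = 0 := by
    rw [mem_halve_iff hNodd, ← hI]
    push_cast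
    rfl
  have hmem (z : ℤ) (hz : (z : ZMod (2 * N)) ∈ X) :
      ((2 * z : ℤ) : ZMod N) ∉ singerSet F ω N := by
    rw [hI]
    exact hflag.trace_sq_ne_zero_of_mem_setD ((hXmem z).mp hz)
  -- multiplication by `ω ^ N`, a nonsquare of `F`, exchanges `D` with its complement among the
  -- anisotropic vectors
  have halt (z : ℤ) (hz : ((2 * z : ℤ) : ZMod N) ∉ singerSet F ω N) :
      ((z + N : ℤ) : ZMod (2 * N)) ∈ X ↔ (z : ZMod (2 * N)) ∉ X := by
    rw [hI] at hz
    rw [hXmem, hXmem, ← hflag.smul_mem_setD_iff_of_not_isSquare hδsq hz]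
    have := hδω z 1
    rw [mul_one, zpow_one] at this
    rw [this]
  have hD : setD F a b = ⋃ t ∈ X, cyclotomicClass ω (2 * N) t := by
    refine eq_iUnion_cyclotomicClass hω (fun h0 => ?_) hXmem
    exact hflag.trace_sq_ne_zero_of_mem_setD h0 (by simp)
  have hY : {x : K | Algebra.trace F K (x ^ 2) ≠ 0} =
      ⋃ t ∈ (halve (singerSet F ω N))ᶜ, cyclotomicClass ω N t :=
    eq_iUnion_cyclotomicClass hω (by simp) fun z => not_congr (hhalve z)
  refine ⟨hD, bijOn_cast_of_alternating hNodd hmem halt,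
    exists_partition_of_alternating hNodd hmem halt, fun c => ?_⟩
  rw [combinedSum, ← hD, ← hY, hflag.two_mul_charSum_sub_charSum hψK (Units.ne_zero _), hhalve, sq,
    ← Algebra.traceForm_apply]
  exact hflag.sum_flagSign_eq hsymm h2 hψ hG _
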